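/- Let $F$ be a field and let $D$ be a subring of $F$ (the quotient field of $D$ may be smaller than $F$). Let $\mathfrak X$ be the Zariski–Riemann space of $F/D$, that is, the set of all valuation rings $V$ with $D\subseteq V\subseteq F$ and with quotient field $F$ (including $V=F$), with the topology that has the sets $\{V\in\mathfrak X : t_1,\dots,t_n\in V\}$, $t_1,\dots,t_n\in F$, as a basis. Let $Z\subseteq\mathfrak X$ be a subspace with $F\in Z$. Regard $Z$ as a locally ringed space with the structure sheaf $\mathcal O_Z(U)=\bigcap_{V\in U}V$ for $U\subseteq Z$ nonempty and open, $\mathcal O_Z(\emptyset)=0$, and with inclusions as restriction maps between nonempty open sets; the stalk at $V$ is $V$. Regard $Z$ as a space over $\operatorname{Spec} D$ through the morphism that sends $V\in Z$ to its center in $D$ (the contraction to $D$ of the maximal ideal of $V$) and whose ring maps are given by the inclusion of $D$ in the rings $\mathcal O_Z(U)$, $U\ne\emptyset$. Let $\mathbb P^1_D=\operatorname{Proj}D[T_0,T_1]$. A $D$-morphism $Z\to\mathbb P^1_D$ is a morphism of locally ringed spaces that is compatible with the structure morphisms to $\operatorname{Spec}D$. Let $A=\bigcap_{V\in Z}V$.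 **Theorem.** Suppose that $D$ is a local ring (it has a unique maximal ideal $\mathfrak m$; it need not be Noetherian), that $D$ is integrally closed in $F$, and that all but finitely many $V\in Z$ dominate $D$, i.e. $\mathfrak m$ is contained in the maximal ideal of $V$. Suppose further that for every $D$-morphism $\phi: Z\to\mathbb P^1_D$ there is a closed point of $\mathbb P^1_D$ that is not in the image of $\phi$. Then $A$ is a Prüfer domain (its localization at every prime ideal is a valuation ring) with quotient field $F$, and the Picard group of $A$ is a torsion group. -/

import Mathlib

open CategoryTheory TopologicalSpace Opposite AlgebraicGeometry

universe u

/-- The Zariski-Riemann space of `F/D`: all valuation rings of `F` that contain `D`. -/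
structure ZariskiRiemannSpace {F : Type u} [Field F] (D : Subring F) : Type u where
  /-- the valuation ring of `F` -/
  ring : ValuationSubring F
  /-- it contains `D` -/
  le_ring : D ≤ ring.toSubring

namespace ZariskiRiemannSpace

variable {F : Type u} [Field F] {D : Subring F}

/-- The sets `{V | t ∈ V}`, `t ∈ F`, form a subbasis, so that their finite intersections
`{V | t₁, …, tₙ ∈ V}` form a basis of the topology. -/
instance : TopologicalSpace (ZariskiRiemannSpace D) :=
  TopologicalSpace.generateFrom (Set.range fun t : F => {V : ZariskiRiemannSpace D | t ∈ V.ring})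

/-- The field `F` itself, as a valuation ring of `F` containing `D`. -/
instance : Top (ZariskiRiemannSpace D) := ⟨⟨⊤, fun _ _ => trivial⟩⟩

lemma isOpen_setOf_mem (t : F) : IsOpen {V : ZariskiRiemannSpace D | t ∈ V.ring} :=
  TopologicalSpace.isOpen_generateFrom_of_mem ⟨t, rfl⟩

lemma top_mem_of_isOpen {U : Set (ZariskiRiemannSpace D)} (hU : IsOpen U)
    {V : ZariskiRiemannSpace D} (hV : V ∈ U) : (⊤ : ZariskiRiemannSpace D) ∈ U := by
  induction hU with
  | basic s hs =>
    obtain ⟨t, rfl⟩ := hs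
    exact trivial
  | univ => trivial
  | inter s t _ _ ihs iht => exact ⟨ihs hV.1, iht hV.2⟩
  | sUnion S _ ih =>
    obtain ⟨s, hs, hVs⟩ := hV
    exact ⟨s, hs, ih s hs hVs⟩

/-- `V` dominates the local ring `D`: it contains `D`, and the maximal ideal of `D` lies in the
maximal ideal of `V`. -/
def Dominates [IsLocalRing D] (V : ZariskiRiemannSpace D) : Prop :=
  ∀ d ∈ IsLocalRing.maximalIdeal D,
    (⟨(d : F), V.le_ring d.2⟩ : V.ring) ∈ IsLocalRing.maximalIdeal V.ring

/-- The holomorphy ring of `Z`: the intersection of the valuation rings in `Z`. -/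
def holomorphyRing (Z : Set (ZariskiRiemannSpace D)) : Subring F :=
  ⨅ V ∈ Z, V.ring.toSubring

section Sheaf

variable (Z : Set (ZariskiRiemannSpace D))

/-- The subring of functions `U → F` that are constant, with value in `⋂_{V ∈ U} V`. For nonempty
`U` it is `⋂_{V ∈ U} V` (see `sectionsEquiv`), and for `U = ∅` it is the zero ring. -/
def sections (U : Opens Z) : Subring (U → F) where
  carrier := {s | ∃ a : F, (∀ V : U, a ∈ V.1.1.ring) ∧ ∀ V : U, s V = a}
  zero_mem' := ⟨0, fun _ => zero_mem _, fun _ => rfl⟩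
  one_mem' := ⟨1, fun _ => one_mem _, fun _ => rfl⟩
  add_mem' := by
    rintro s t ⟨a, ha, hs⟩ ⟨b, hb, ht⟩
    exact ⟨a + b, fun V => add_mem (ha V) (hb V), fun V => by simp [hs, ht]⟩
  mul_mem' := by
    rintro s t ⟨a, ha, hs⟩ ⟨b, hb, ht⟩
    exact ⟨a * b, fun V => mul_mem (ha V) (hb V), fun V => by simp [hs, ht]⟩
  neg_mem' := by
    rintro s ⟨a, ha, hs⟩
    exact ⟨-a, fun V => neg_mem (ha V), fun V => by simp [hs]⟩

/-- An element of `⋂_{V ∈ U} V` as a section over `U`. -/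
def constSection (U : Opens Z) :
    (⨅ V : U, V.1.1.ring.toSubring : Subring F) →+* sections Z U where
  toFun a := ⟨fun _ => a.1, a.1, fun V => (Subring.mem_iInf.1 a.2) V, fun _ => rfl⟩
  map_one' := rfl
  map_mul' _ _ := rfl
  map_zero' := rfl
  map_add' _ _ := rfl

/-- The ring of sections over a nonempty open set `U` is `⋂_{V ∈ U} V`. -/
noncomputable def sectionsEquiv (U : Opens Z) (hU : (U : Set Z).Nonempty) :
    (⨅ V : U, V.1.1.ring.toSubring : Subring F) ≃+* sections Z U :=
  RingEquiv.ofBijective (constSection Z U) <| by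
    obtain ⟨V, hV⟩ := hU
    constructor
    · intro a b h
      exact Subtype.ext (congrFun (congrArg Subtype.val h) ⟨V, hV⟩)
    · rintro ⟨s, a, ha, hs⟩
      exact ⟨⟨a, Subring.mem_iInf.2 ha⟩, Subtype.ext (funext fun W => (hs W).symm)⟩

/-- The holomorphy presheaf on `Z`; restriction maps are restrictions of (constant) functions,
that is, inclusions. -/
def presheaf : TopCat.Presheaf CommRingCat.{u} (TopCat.of Z) where
  obj U := CommRingCat.of (sections Z U.unop)
  map {U W} i := CommRingCat.ofHom
    { toFun := fun s => ⟨fun V => s.1 ⟨V.1, i.unop.le V.2⟩, by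
        obtain ⟨a, ha, hs⟩ := s.2
        exact ⟨a, fun V => ha ⟨V.1, i.unop.le V.2⟩, fun V => hs ⟨V.1, i.unop.le V.2⟩⟩⟩
      map_one' := rfl
      map_mul' := fun _ _ => rfl
      map_zero' := rfl
      map_add' := fun _ _ => rfl }

variable {Z}

lemma top_mem_opens (hZ : ⊤ ∈ Z) (U : Opens Z) {V : Z} (hV : V ∈ U) :
    (⟨⊤, hZ⟩ : Z) ∈ U := by
  obtain ⟨W, hW, hWU⟩ := isOpen_induced_iff.1 U.isOpen
  have hV' : V ∈ (Subtype.val ⁻¹' W : Set Z) := hWU ▸ hV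
  have : (⟨⊤, hZ⟩ : Z) ∈ (Subtype.val ⁻¹' W : Set Z) := top_mem_of_isOpen hW hV'
  rw [hWU] at this
  exact this

/-- Being a section is a local condition, because every nonempty open set contains the point
`F`. -/
def sectionPredicate (hZ : ⊤ ∈ Z) : TopCat.LocalPredicate (X := TopCat.of Z) fun _ => F where
  pred {U} s := s ∈ sections Z U
  res := by
    rintro U W i s ⟨a, ha, hs⟩
    exact ⟨a, fun V => ha ⟨V.1, i.le V.2⟩, fun V => hs ⟨V.1, i.le V.2⟩⟩
  locality := by
    intro U s h
    by_cases hU : (⟨⊤, hZ⟩ : Z) ∈ U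
    · have key : ∀ V : U, s V = s ⟨⟨⊤, hZ⟩, hU⟩ ∧ s V ∈ V.1.1.ring := by
        intro V
        obtain ⟨W, hVW, i, a, ha, hs⟩ := h V
        have h1 := hs ⟨V.1, hVW⟩
        have h2 := hs ⟨⟨⊤, hZ⟩, top_mem_opens hZ W hVW⟩
        refine ⟨h1.trans h2.symm, ?_⟩
        have h3 := ha ⟨V.1, hVW⟩
        rw [← h1] at h3
        exact h3
      exact ⟨s ⟨⟨⊤, hZ⟩, hU⟩, fun V => (key V).1 ▸ (key V).2, fun V => (key V).1⟩
    · have hE : ∀ V : U, False := fun V => hU (top_mem_opens hZ U V.2)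
      exact ⟨0, fun V => (hE V).elim, fun V => (hE V).elim⟩

lemma presheaf_isSheaf (hZ : ⊤ ∈ Z) : (presheaf Z).IsSheaf :=
  (TopCat.Presheaf.isSheaf_iff_isSheaf_comp (forget CommRingCat.{u}) (presheaf Z)).2 <|
    TopCat.Presheaf.isSheaf_of_iso
      (F := (TopCat.subsheafToTypes (sectionPredicate hZ)).1)
      (NatIso.ofComponents (fun _ => Iso.refl _) (by cat_disch))
      (TopCat.subsheafToTypes (sectionPredicate hZ)).2

/-- Evaluation of sections at the point `V`. -/
def evalAt (U : Opens Z) (V : Z) (hV : V ∈ U) : sections Z U →+* V.1.ring where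
  toFun s := ⟨s.1 ⟨V, hV⟩, by
    obtain ⟨a, ha, hs⟩ := s.2
    rw [hs]
    exact ha ⟨V, hV⟩⟩
  map_one' := rfl
  map_mul' _ _ := rfl
  map_zero' := rfl
  map_add' _ _ := rfl

/-- The map from the stalk at `V` to `V`. -/
noncomputable def stalkTo (V : TopCat.of Z) :
    (presheaf Z).stalk V ⟶ CommRingCat.of V.1.ring :=
  Limits.colimit.desc ((OpenNhds.inclusion V).op ⋙ presheaf Z)
    { pt := _
      ι :=
        { app := fun U =>
            CommRingCat.ofHom (evalAt ((OpenNhds.inclusion V).obj U.unop) V U.unop.2) } }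

lemma germ_stalkTo (U : Opens (TopCat.of Z)) (V : TopCat.of Z) (hV : V ∈ U) :
    (presheaf Z).germ U V hV ≫ stalkTo V = CommRingCat.ofHom (evalAt U V hV) :=
  Limits.colimit.ι_desc _ _

lemma stalkTo_germ (U : Opens (TopCat.of Z)) (V : TopCat.of Z) (hV : V ∈ U)
    (s : sections Z U) :
    (stalkTo V).hom (((presheaf Z).germ U V hV).hom s) = evalAt U V hV s :=
  RingHom.ext_iff.1 (CommRingCat.hom_ext_iff.mp (germ_stalkTo U V hV)) s

lemma stalkTo_bijective (V : TopCat.of Z) : Function.Bijective (stalkTo V).hom := by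
  constructor
  · rw [injective_iff_map_eq_zero]
    intro x hx
    obtain ⟨U, hV, s, rfl⟩ := (presheaf Z).exists_germ_eq x
    have h := stalkTo_germ U V hV s
    have h0 : evalAt U V hV s = 0 := h.symm.trans hx
    have hs : s = 0 := by
      obtain ⟨s, a, ha, hs⟩ := s
      have : s ⟨V, hV⟩ = 0 := congrArg Subtype.val h0
      refine Subtype.ext (funext fun W => ?_)
      change s W = 0
      rw [hs, ← hs ⟨V, hV⟩, this]
    subst hs
    exact map_zero ((presheaf Z).germ U V hV).hom
  · intro a
    let U : Opens (TopCat.of Z) :=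
      ⟨{W | (a : F) ∈ W.1.ring}, (isOpen_setOf_mem (D := D) (a : F)).preimage continuous_subtype_val⟩
    let s : sections Z U := ⟨fun _ => a, a, fun W => W.2, fun _ => rfl⟩
    exact ⟨((presheaf Z).germ U V a.2).hom s, stalkTo_germ U V a.2 s⟩

/-- The stalk at `V` is `V`. -/
noncomputable def stalkEquiv (V : TopCat.of Z) : (presheaf Z).stalk V ≃+* V.1.ring :=
  RingEquiv.ofBijective (stalkTo V).hom (stalkTo_bijective V)

/-- The subspace `Z` of the Zariski-Riemann space of `F/D`, with `F ∈ Z`, as a locally ringed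
space. -/
noncomputable def toLocallyRingedSpace (Z : Set (ZariskiRiemannSpace D)) (hZ : ⊤ ∈ Z) :
    LocallyRingedSpace.{u} where
  carrier := TopCat.of Z
  presheaf := presheaf Z
  IsSheaf := presheaf_isSheaf hZ
  isLocalRing V := (stalkEquiv V).symm.isLocalRing

/-- The inclusion of `D` into the ring of sections over `U`. -/
def baseToSections (Z : Set (ZariskiRiemannSpace D)) (U : Opens Z) : D →+* sections Z U where
  toFun d := ⟨fun _ => d, d, fun V => V.1.1.le_ring d.2, fun _ => rfl⟩
  map_one' := rfl
  map_mul' _ _ := rfl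
  map_zero' := rfl
  map_add' _ _ := rfl

/-- The canonical morphism `Z ⟶ Spec D`: the morphism of locally ringed spaces that corresponds to
the inclusion of `D` into the ring of global sections of `Z`. It sends each valuation ring to its
center in `D` (`structureMorphism_apply`), and its ring maps are inclusions
(`structureMorphism_sections`). -/
noncomputable def structureMorphism (Z : Set (ZariskiRiemannSpace D)) (hZ : ⊤ ∈ Z) :
    toLocallyRingedSpace Z hZ ⟶ (Spec (CommRingCat.of D)).toLocallyRingedSpace :=
  (toLocallyRingedSpace Z hZ).toΓSpec ≫
    Spec.locallyRingedSpaceMap (CommRingCat.ofHom (baseToSections Z ⊤))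

lemma structureMorphism_apply (Z : Set (ZariskiRiemannSpace D)) (hZ : ⊤ ∈ Z) (V : Z) :
    (structureMorphism Z hZ).base V =
      PrimeSpectrum.comap (Subring.inclusion V.1.le_ring)
        (IsLocalRing.closedPoint V.1.ring) := by
  refine PrimeSpectrum.ext (Ideal.ext fun d => not_iff_not.1 ?_)
  have h1 : d ∉ ((structureMorphism Z hZ).base V).asIdeal ↔
      IsUnit ((toLocallyRingedSpace Z hZ).presheaf.Γgerm V (baseToSections Z ⊤ d)) :=
    (toLocallyRingedSpace Z hZ).notMem_prime_iff_unit_in_stalk (baseToSections Z ⊤ d) V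
  have h2 : stalkEquiv (Z := Z) V
      ((toLocallyRingedSpace Z hZ).presheaf.Γgerm V (baseToSections Z ⊤ d)) =
      Subring.inclusion V.1.le_ring d :=
    stalkTo_germ (Z := Z) ⊤ V trivial (baseToSections Z ⊤ d)
  have h3 : IsUnit (Subring.inclusion V.1.le_ring d) ↔
      IsUnit ((toLocallyRingedSpace Z hZ).presheaf.Γgerm V (baseToSections Z ⊤ d)) := by
    rw [← h2]
    exact MulEquiv.isUnit_map (stalkEquiv (Z := Z) V)
  exact h1.trans (h3.symm.trans (IsLocalRing.notMem_maximalIdeal (R := V.1.ring)).symm)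

lemma structureMorphism_sections (Z : Set (ZariskiRiemannSpace D)) (hZ : ⊤ ∈ Z)
    (U : Opens (PrimeSpectrum D)) (d : D) :
    ((structureMorphism Z hZ).c.app (op U)).hom
        (algebraMap D ((structureSheafInType D D).1.obj (op U)) d) =
      baseToSections Z ((Opens.map (structureMorphism Z hZ).base).obj U) d :=
  RingHom.ext_iff.1 (CommRingCat.hom_ext_iff.mp
    (ΓSpec.toOpen_comp_locallyRingedSpaceAdjunction_homEquiv_app
      (X := toLocallyRingedSpace Z hZ) (CommRingCat.ofHom (baseToSections Z ⊤)).op (op U))) d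

end Sheaf

end ZariskiRiemannSpace

section ProjectiveLine

attribute [local instance] MvPolynomial.gradedAlgebra

/-- The projective line `Proj R[T₀, T₁]` over `R`. -/
noncomputable def projectiveLine (R : Type u) [CommRing R] : Scheme.{u} :=
  Proj (MvPolynomial.homogeneousSubmodule (Fin 2) R)

/-- The structure morphism of the projective line, induced by the inclusion of `R` as constant
polynomials. -/
noncomputable def projectiveLineToSpec (R : Type u) [CommRing R] :
    projectiveLine R ⟶ Spec (CommRingCat.of R) :=
  Proj.toSpecZero (MvPolynomial.homogeneousSubmodule (Fin 2) R) ≫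
    Spec.map (CommRingCat.ofHom (algebraMap R (MvPolynomial.homogeneousSubmodule (Fin 2) R 0)))

end ProjectiveLine

/-- A Prüfer domain: a domain all of whose localizations at prime ideals are valuation rings. -/
structure IsPruferDomain (A : Type u) [CommRing A] : Prop where
  isDomain : IsDomain A
  valuationRing : ∀ (P : Ideal A) [P.IsPrime], ValuationRing (Localization.AtPrime P)

/-! Each `t : F` defines a `D`-morphism `(1 : t)` from `Z` to the projective line (`lineMorphism`),
which by hypothesis misses a closed point `x`. The structure map of the line is closed, so `x` lies
over `𝔪`, and within the closed fibre `x` is the only zero of some form `f` of positive degree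
(`exists_form_of_isClosed`). Dominating valuation rings are sent into the closed fibre, hence `f`
vanishes at none of their images. Adding to `f` suitable forms with coefficients in `𝔪` changes
nothing there and removes the zeros at the finitely many remaining images
(`exists_form_notMem_linePoint`). The resulting form `g`, of degree `n + 1`, vanishes nowhere on the
image of `Z`, which means that `u = g(1, t)` generates `(1, t)ⁿ⁺¹` in every `V ∈ Z`
(`notMem_linePoint_iff_forall`). Since `u` is also a `D`-combination of the powers `tⁱ`, it follows
that `(1, t)ⁿ⁺¹ = uA`. The rest is ideal theory: if every `(1, t)` has a principal power, then `A`
is Prüfer with quotient field `F`, and by induction on the number of generators every nonzero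
finitely generated fractional ideal has a principal power. Invertible ideals are finitely generated,
so the Picard group is torsion. -/

/-! ### Fractional ideals with principal powers. -/

section PrincipalPowers

variable {A F : Type u} [CommRing A] [Field F] [Algebra A F]

/-- A submodule some positive power of which is generated by a nonzero element. -/
def HasPrincipalPower (I : Submodule A F) : Prop :=
  ∃ n : ℕ, ∃ u : F, u ≠ 0 ∧ I ^ (n + 1) = Submodule.span A {u}

lemma isUnit_span_singleton {u : F} (hu : u ≠ 0) : IsUnit (Submodule.span A {u}) := by
  refine IsUnit.of_mul_eq_one (Submodule.span A {u⁻¹}) ?_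
  rw [Submodule.span_mul_span, Set.singleton_mul_singleton, mul_inv_cancel₀ hu,
    Submodule.one_eq_span]

lemma HasPrincipalPower.isUnit {I : Submodule A F} (h : HasPrincipalPower I) : IsUnit I := by
  obtain ⟨n, u, hu, h⟩ := h
  exact (isUnit_pow_iff n.succ_ne_zero).1 (h ▸ isUnit_span_singleton hu)

lemma hasPrincipalPower_span_singleton {a : F} (ha : a ≠ 0) :
    HasPrincipalPower (Submodule.span A {a}) :=
  ⟨0, a, ha, by simp⟩

lemma HasPrincipalPower.of_pow {I : Submodule A F} {n : ℕ}
    (h : HasPrincipalPower (I ^ (n + 1))) : HasPrincipalPower I := by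
  obtain ⟨k, u, hu, h⟩ := h
  refine ⟨n * k + n + k, u, hu, ?_⟩
  rw [← h, ← pow_mul]
  congr 1
  ring

/-- In an invertible sum of two submodules, equal powers may be taken termwise. -/
lemma add_pow_eq_of_isUnit {I J : Submodule A F} (h : IsUnit (I + J)) (m : ℕ) :
    (I + J) ^ (m + 1) = I ^ (m + 1) + J ^ (m + 1) := by
  -- It suffices to compare after multiplying by `(I + J)ᵐ`: in each term `Iⁱ Jʲ` with `i + j = 2m +
  -- 1`, one exponent is at least `m + 1`.
  refine (h.pow m).mul_right_cancel ?_
  refine le_antisymm ?_ ?_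
  · rw [← pow_add, add_pow]
    refine Finset.sum_induction _
      (fun X => X ≤ (I ^ (m + 1) + J ^ (m + 1)) * (I + J) ^ m) (fun X Y hX hY => ?_) ?_ ?_
    · exact sup_le hX hY
    · exact bot_le
    · intro i hi
      have hi' : i ≤ m + 1 + m := by simpa [Nat.lt_succ_iff] using hi
      -- Addition of submodules is the supremum, so binomial coefficients are at most `1`.
      have h1 : ∀ k : ℕ, (k : Submodule A F) ≤ 1 := by
        intro k
        induction k with
        | zero => simp
        | succ k ih => rw [Nat.cast_succ]; exact sup_le ih le_rfl
      refine (mul_le_mul_right (h1 _) _).trans ?_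
      rw [mul_one]
      rcases le_total (m + 1) i with h2 | h2
      · obtain ⟨k, rfl⟩ := Nat.exists_eq_add_of_le h2
        have h3 : m + 1 + m - (m + 1 + k) = m - k := by omega
        have h4 : m = k + (m - k) := by omega
        rw [h3, pow_add, mul_assoc]
        refine mul_le_mul' le_sup_left ?_
        conv_rhs => rw [h4, pow_add]
        exact mul_le_mul' (pow_le_pow_left' le_sup_left _) (pow_le_pow_left' le_sup_right _)
      · rcases eq_or_lt_of_le h2 with h2 | h2
        · subst h2
          rw [Nat.add_sub_cancel_left]
          exact mul_le_mul' le_sup_left (pow_le_pow_left' le_sup_right _)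
        have h3 : m + 1 + m - i = (m - i) + (m + 1) := by omega
        have h4 : m = i + (m - i) := by omega
        rw [h3, pow_add, ← mul_assoc, mul_comm]
        refine mul_le_mul' le_sup_right ?_
        conv_rhs => rw [h4, pow_add]
        exact mul_le_mul' (pow_le_pow_left' le_sup_left _) (pow_le_pow_left' le_sup_right _)
  · refine mul_le_mul' (sup_le ?_ ?_) le_rfl
    · exact pow_le_pow_left' le_sup_left _
    · exact pow_le_pow_left' le_sup_right _

variable (A F) in
/-- Every fractional ideal `(1, t)` of `A` has a principal power, in terms of elements. -/
def HasPrincipalPowers : Prop :=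
  ∀ t : F, ∃ n : ℕ, ∃ u : F, u ≠ 0 ∧
    (∀ i ≤ n + 1, ∃ w : A, t ^ i / u = algebraMap A F w) ∧
    ∃ c : ℕ → A, ∑ i ∈ Finset.range (n + 2), algebraMap A F (c i) * t ^ i = u

open scoped Pointwise in
lemma exists_eq_of_mem_pair_pow {a b x : F} {m : ℕ} (hx : x ∈ ({a, b} : Set F) ^ m) :
    ∃ i ≤ m, x = a ^ (m - i) * b ^ i := by
  induction m generalizing x with
  | zero => exact ⟨0, le_rfl, by simpa using hx⟩
  | succ m ih =>
    rw [pow_succ] at hx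
    obtain ⟨y, hy, z, hz, rfl⟩ := hx
    obtain ⟨i, hi, rfl⟩ := ih hy
    rcases hz with rfl | hz
    · refine ⟨i, by omega, ?_⟩
      rw [Nat.succ_sub hi, pow_succ]
      ring
    · rw [Set.mem_singleton_iff] at hz
      subst hz
      refine ⟨i + 1, by omega, ?_⟩
      rw [Nat.add_sub_add_right, pow_succ]
      ring

lemma HasPrincipalPowers.pair (h : HasPrincipalPowers A F) {a b : F} (ha : a ≠ 0) :
    HasPrincipalPower (Submodule.span A {a} + Submodule.span A {b}) := by
  obtain ⟨n, u, hu, hw, c, hc⟩ := h (b / a)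
  have hI : Submodule.span A {a} + Submodule.span A {b} = Submodule.span A {a, b} := by
    rw [Set.insert_eq, Submodule.span_union]
    rfl
  rw [hI]
  refine ⟨n, a ^ (n + 1) * u, mul_ne_zero (pow_ne_zero _ ha) hu, le_antisymm ?_ ?_⟩
  · rw [Submodule.span_pow, Submodule.span_le]
    intro x hx
    obtain ⟨i, hi, rfl⟩ := exists_eq_of_mem_pair_pow hx
    obtain ⟨w, hw⟩ := hw i hi
    rw [SetLike.mem_coe, Submodule.mem_span_singleton]
    refine ⟨w, ?_⟩
    rw [Algebra.smul_def, ← hw, ← Nat.sub_add_cancel hi, pow_add, Nat.add_sub_cancel, div_pow]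
    field_simp
  · rw [Submodule.span_le, Set.singleton_subset_iff, ← hc, Finset.mul_sum]
    refine Submodule.sum_mem _ fun i hi => ?_
    have hi : i ≤ n + 1 := by simpa [Nat.lt_succ_iff] using hi
    have : a ^ (n + 1) * (algebraMap A F (c i) * (b / a) ^ i) =
        c i • (a ^ (n + 1 - i) * b ^ i) := by
      rw [Algebra.smul_def]
      conv_lhs => rw [← Nat.sub_add_cancel hi, pow_add, div_pow]
      field_simp
    rw [this]
    refine Submodule.smul_mem _ _ ?_
    have h2 := Submodule.mul_mem_mul
      (Submodule.pow_mem_pow _ (Submodule.subset_span (R := A) (Set.mem_insert a {b})) (n + 1 - i))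
      (Submodule.pow_mem_pow _ (Submodule.subset_span (R := A)
        (Set.mem_insert_of_mem a rfl : b ∈ ({a, b} : Set F))) i)
    rwa [← pow_add, Nat.sub_add_cancel hi] at h2

/-- With `I = (a)`, `J = (b)` and `R` spanned by the rest, induction handles `J + R` and `I + R`,
which makes `I + J + R` invertible. If `(J + R)ᵐ⁺¹ = (u)`, termwise powers give `(I + J + R)ᵐ⁺¹ =
(aᵐ⁺¹, u)`, a case with two generators. -/
lemma HasPrincipalPowers.list (h : HasPrincipalPowers A F) :
    ∀ (a : F) (l : List F), a ≠ 0 → (∀ b ∈ l, b ≠ 0) →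
      HasPrincipalPower (((a :: l).map fun x => Submodule.span A {x}).sum)
  | a, [], ha, _ => by simpa using hasPrincipalPower_span_singleton ha
  | a, [b], ha, _ => by simpa using h.pair (b := b) ha
  | a, b :: c :: l, ha, hl => by
    have hb : b ≠ 0 := hl b (by simp)
    have hJ := HasPrincipalPowers.list h b (c :: l) hb fun x hx => hl x (by simp_all)
    have hab : HasPrincipalPower (Submodule.span A {a} + Submodule.span A {b}) := h.pair ha
    have haR := HasPrincipalPowers.list h a (c :: l) ha fun x hx => hl x (by simp_all)
    rw [List.map_cons, List.sum_cons] at hJ haR ⊢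
    rw [List.map_cons, List.sum_cons]
    generalize ((c :: l).map fun x => Submodule.span A {x}).sum = R at hJ haR ⊢
    generalize hI : Submodule.span A {a} = I at hab haR ⊢
    generalize Submodule.span A {b} = J at hab hJ ⊢
    have hK : IsUnit (I + (J + R)) := by
      have hid : ∀ X : Submodule A F, X + X = X := fun X => sup_idem X
      -- In commuting variables the sides differ by `I * J * R`, which idempotence of addition
      -- absorbs.
      have h3 : (I + (J + R)) * (I * J + J * R + R * I) = (I + J) * (J + R) * (I + R) := by
        have h4 : (I + (J + R)) * (I * J + J * R + R * I) =
            (I + J) * (J + R) * (I + R) + I * J * R := by ring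
        have h5 : (I + J) * (J + R) * (I + R) = (I * J * I + I * J * R + (I * R * I + I * R * R) +
            (J * J * I + J * J * R + (J * R * R))) + I * J * R := by ring
        rw [h4, h5, add_assoc, hid]
      exact isUnit_of_mul_isUnit_left
        (h3 ▸ (hab.isUnit.mul hJ.isUnit).mul haR.isUnit)
    obtain ⟨m, u, hu, hm⟩ := hJ
    refine HasPrincipalPower.of_pow (n := m) ?_
    rw [add_pow_eq_of_isUnit hK, hm, ← hI, Submodule.span_pow, Set.singleton_pow]
    exact h.pair (pow_ne_zero _ ha)

lemma HasPrincipalPowers.of_fg (h : HasPrincipalPowers A F) {I : Submodule A F} (hI : I.FG)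
    (h0 : I ≠ ⊥) : HasPrincipalPower I := by
  classical
  obtain ⟨s, rfl⟩ := hI
  have hs : Submodule.span A (s : Set F) =
      ((s.erase 0).toList.map fun x => Submodule.span A {x}).sum := by
    rw [← Submodule.span_sdiff_singleton_zero, ← Finset.coe_erase]
    generalize s.erase 0 = t
    rw [Finset.sum_map_toList]
    induction t using Finset.induction_on with
    | empty => simp
    | insert a t ha ih =>
      rw [Finset.coe_insert, Finset.sum_insert ha, ← ih, Submodule.span_insert]
      rfl
  rw [hs] at h0 ⊢
  have hz : ∀ x ∈ (s.erase 0).toList, x ≠ 0 := by simp +contextual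
  generalize (s.erase 0).toList = l at h0 hz ⊢
  match l, h0, hz with
  | [], h0, _ => exact absurd (by simp) h0
  | a :: l, _, hz =>
    exact h.list a l (hz a (by simp)) fun b hb => hz b (List.mem_cons_of_mem _ hb)

lemma HasPrincipalPowers.isMulTorsion_pic [IsDomain A] [IsFractionRing A F]
    (h : HasPrincipalPowers A F) : IsMulTorsion (CommRing.Pic A) := by
  refine IsMulTorsion.of_surjective (f := (ClassGroup.equivPic A).toMonoidHom)
    (ClassGroup.equivPic A).surjective fun x => ?_
  refine ClassGroup.induction F (fun I => ?_) x
  have h0 : (I : Submodule A F) ≠ ⊥ := fun h0 =>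
    I.ne_zero (FractionalIdeal.coeToSubmodule_injective (by simpa using h0))
  obtain ⟨n, u, hu, hn⟩ := h.of_fg (FractionalIdeal.fg_unit I) h0
  rw [isOfFinOrder_iff_pow_eq_one]
  refine ⟨n + 1, n.succ_pos, ?_⟩
  rw [← map_pow, ClassGroup.mk_eq_one_iff]
  refine ⟨u, ?_⟩
  rw [← hn]
  simp

/-- `t = (t / u) / (1 / u)`, and both terms lie in `A`. -/
lemma HasPrincipalPowers.isFractionRing [IsDomain A] [FaithfulSMul A F]
    (h : HasPrincipalPowers A F) : IsFractionRing A F := by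
  refine IsFractionRing.of_field A F fun t => ?_
  obtain ⟨n, u, hu, hw, -⟩ := h t
  obtain ⟨x, hx⟩ := hw 1 (by omega)
  obtain ⟨y, hy⟩ := hw 0 (by omega)
  refine ⟨x, y, ?_⟩
  rw [← hx, ← hy]
  field_simp

/-- For `t = y / x` put `wᵢ = tⁱ / u ∈ A`. As `∑ cᵢ wᵢ = 1`, some `wᵢ` is a unit at `P`, and `x wᵢ₊₁
= y wᵢ` gives `x ∣ y` if `i ≤ n`. For `i = n + 1` the preceding relation gives `y ∣ x`; this needs a
positive exponent. -/
lemma HasPrincipalPowers.valuationRing_localization [IsDomain A] [FaithfulSMul A F]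
    (h : HasPrincipalPowers A F) (P : Ideal A) [P.IsPrime] :
    ValuationRing (Localization.AtPrime P) := by
  have inj : Function.Injective (algebraMap A F) := FaithfulSMul.algebraMap_injective A F
  have key : ∀ x y : A, algebraMap A (Localization.AtPrime P) x ∣ algebraMap A _ y ∨
      algebraMap A (Localization.AtPrime P) y ∣ algebraMap A _ x := by
    intro x y
    by_cases hx : x = 0
    · subst hx
      right
      simp
    have hx' : algebraMap A F x ≠ 0 := (map_ne_zero_iff _ inj).2 hx
    obtain ⟨n, u, hu, hw, c, hc⟩ := h (algebraMap A F y / algebraMap A F x)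
    choose! w hw using hw
    have hsum : ∑ i ∈ Finset.range (n + 2), c i * w i = 1 := by
      apply inj
      rw [map_sum, map_one, ← div_self hu]
      conv_rhs => rw [← hc, Finset.sum_div]
      rw [hc]
      refine Finset.sum_congr rfl fun i hi => ?_
      rw [map_mul, ← hw i (by simpa [Nat.lt_succ_iff] using hi), mul_div_assoc]
    obtain ⟨i, hi, hiP⟩ : ∃ i ≤ n + 1, w i ∉ P := by
      by_contra! hcon
      refine ‹P.IsPrime›.ne_top ((Ideal.eq_top_iff_one _).2 (hsum ▸ Ideal.sum_mem _ fun i hi => ?_))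
      exact P.mul_mem_left _ (hcon i (by simpa [Nat.lt_succ_iff] using hi))
    have hunit : IsUnit (algebraMap A (Localization.AtPrime P) (w i)) :=
      IsLocalization.map_units (M := P.primeCompl) _ ⟨w i, hiP⟩
    rcases hi.lt_or_eq with hi' | rfl
    · left
      have h1 : x * w (i + 1) = y * w i := by
        apply inj
        rw [map_mul, map_mul, ← hw i hi, ← hw (i + 1) hi', pow_succ]
        field_simp
      rw [← hunit.dvd_mul_right, ← map_mul, ← h1, map_mul]
      exact dvd_mul_right _ _
    · right
      have h1 : y * w n = x * w (n + 1) := by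
        apply inj
        rw [map_mul, map_mul, ← hw n (by omega), ← hw (n + 1) le_rfl, pow_succ]
        field_simp
      rw [← hunit.dvd_mul_right, ← map_mul, ← h1, map_mul]
      exact dvd_mul_right _ _
  have : IsDomain (Localization.AtPrime P) := inferInstance
  refine ValuationRing.iff_dvd_total.2 ⟨fun a b => ?_⟩
  obtain ⟨x, s, rfl⟩ := IsLocalization.exists_mk'_eq P.primeCompl a
  obtain ⟨y, s', rfl⟩ := IsLocalization.exists_mk'_eq P.primeCompl b
  have hs : ∀ (x : A) (s : P.primeCompl), Associated
      (IsLocalization.mk' (Localization.AtPrime P) x s) (algebraMap A _ x) := fun x s =>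
    ⟨(IsLocalization.map_units (Localization.AtPrime P) s).unit, by simp⟩
  rw [(hs x s).dvd_iff_dvd_left, (hs y s').dvd_iff_dvd_right, (hs y s').dvd_iff_dvd_left,
    (hs x s).dvd_iff_dvd_right]
  exact key x y

end PrincipalPowers

/-! ### Stalks of `Proj` and its map to the spectrum of the degree zero part. -/

section ProjStructure

variable {σ : Type*} {A : Type u} [CommRing A] [SetLike σ A] [AddSubgroupClass σ A]
  (𝒜 : ℕ → σ) [GradedRing 𝒜]

lemma isUnit_mk_atPrime_iff (P : Ideal A) [hP : P.IsPrime]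
    (c : HomogeneousLocalization.NumDenSameDeg 𝒜 P.primeCompl) :
    IsUnit (HomogeneousLocalization.mk c : HomogeneousLocalization.AtPrime 𝒜 P) ↔
      (c.num : A) ∉ P := by
  rw [← HomogeneousLocalization.isUnit_iff_isUnit_val, HomogeneousLocalization.val_mk,
    Localization.mk_eq_mk', IsLocalization.AtPrime.isUnit_mk'_iff]
  rfl

/-- Elements of degree zero as global sections of `Proj`. -/
noncomputable def zeroToΓ : CommRingCat.of (𝒜 0) ⟶ Γ(Proj 𝒜, ⊤) :=
  CommRingCat.ofHom (HomogeneousLocalization.fromZeroRingHom 𝒜 _) ≫ Proj.awayToSection 𝒜 1 ≫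
    (Proj 𝒜).presheaf.map (homOfLE (Proj.basicOpen_one 𝒜).ge).op

/-- In this form images of points, and composites with morphisms into `Proj`, can be computed on
global sections. -/
lemma toSpecZero_eq : Proj.toSpecZero 𝒜 = (Proj 𝒜).toSpecΓ ≫ Spec.map (zeroToΓ 𝒜) := by
  have h : ((Proj 𝒜).isoOfEq (Proj.basicOpen_one 𝒜)).inv =
      (Proj 𝒜).homOfLE (Proj.basicOpen_one 𝒜).ge := by
    rw [← cancel_mono (Scheme.Opens.ι _)]
    simp
  rw [Proj.toSpecZero, Proj.basicOpenToSpec, h, Category.assoc,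
    ← Scheme.Opens.toSpecΓ_SpecMap_presheaf_map_assoc, Scheme.Opens.toSpecΓ_top]
  simp [zeroToΓ, ← Scheme.topIso_hom]

lemma isUnit_germ_iff (x : Proj 𝒜) (W : (Proj 𝒜).Opens) (hx : x ∈ W) (s : Γ(Proj 𝒜, W)) :
    IsUnit ((Proj 𝒜).presheaf.germ W x hx s) ↔ IsUnit (s.1 ⟨x, hx⟩) :=
  (MulEquiv.isUnit_map (Proj.stalkIso' 𝒜 x)).symm.trans
    (iff_of_eq (congrArg IsUnit (Proj.stalkIso'_germ 𝒜 W x hx s)))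

lemma mem_toSpecZero_iff (x : Proj 𝒜) (a : 𝒜 0) :
    a ∈ (Proj.toSpecZero 𝒜 x).asIdeal ↔ (a : A) ∈ ProjectiveSpectrum.asHomogeneousIdeal x := by
  rw [toSpecZero_eq, Scheme.Hom.comp_apply, Scheme.toSpecΓ_apply]
  refine not_iff_not.1 ?_
  have h : a ∉ (Spec.map (zeroToΓ 𝒜) (Spec.map ((Proj 𝒜).presheaf.Γgerm x)
      (IsLocalRing.closedPoint ((Proj 𝒜).presheaf.stalk x)))).asIdeal ↔
      IsUnit ((Proj 𝒜).presheaf.Γgerm x ((zeroToΓ 𝒜).hom a)) :=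
    IsLocalRing.notMem_maximalIdeal
  exact h.trans ((isUnit_germ_iff 𝒜 x ⊤ trivial _).trans
    (isUnit_mk_atPrime_iff 𝒜 _ _ (hP := ProjectiveSpectrum.isPrime x)))

end ProjStructure

/-! ### Closed points of the projective line over a local ring lie in the closed fibre. -/

section ProjectiveLineToSpec
attribute [local instance] MvPolynomial.gradedAlgebra
variable (R : Type u) [CommRing R]

/-- The elements of `R` as global sections of the projective line. -/
noncomputable def projectiveLineConst : CommRingCat.of R ⟶ Γ(projectiveLine R, ⊤) :=
  CommRingCat.ofHom (algebraMap R (MvPolynomial.homogeneousSubmodule (Fin 2) R 0)) ≫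
    zeroToΓ (MvPolynomial.homogeneousSubmodule (Fin 2) R)

lemma projectiveLineToSpec_eq : projectiveLineToSpec R =
    (projectiveLine R).toSpecΓ ≫ Spec.map (projectiveLineConst R) := by
  refine (congrArg (· ≫ Spec.map _) (toSpecZero_eq _)).trans ?_
  refine (Category.assoc _ _ _).trans ?_
  rw [← Spec.map_comp]
  rfl

lemma mem_projectiveLineToSpec_iff (x : projectiveLine R) (d : R) :
    d ∈ (projectiveLineToSpec R x).asIdeal ↔
      (MvPolynomial.C d : MvPolynomial (Fin 2) R) ∈ ProjectiveSpectrum.asHomogeneousIdeal x :=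
  mem_toSpecZero_iff _ x _

/-- `Proj` of an algebra of finite type is universally closed over the spectrum of its degree zero
part. Forms of degree zero are constants, so the second factor is a closed immersion. -/
lemma isClosed_projectiveLineToSpec (x : projectiveLine R) (hx : IsClosed {x}) :
    IsClosed {projectiveLineToSpec R x} := by
  have : IsScalarTower R (MvPolynomial.homogeneousSubmodule (Fin 2) R 0)
      (MvPolynomial (Fin 2) R) := ⟨fun a p q => smul_mul_assoc a (p : MvPolynomial (Fin 2) R) q⟩
  have : Algebra.FiniteType (MvPolynomial.homogeneousSubmodule (Fin 2) R 0)
      (MvPolynomial (Fin 2) R) := Algebra.FiniteType.of_restrictScalars_finiteType R _ _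
  have h1 := (Proj.toSpecZero (MvPolynomial.homogeneousSubmodule (Fin 2) R)).isClosedMap {x} hx
  have h2 : Function.Surjective
      (algebraMap R (MvPolynomial.homogeneousSubmodule (Fin 2) R 0)) := by
    rintro ⟨p, hp⟩
    refine ⟨p.coeff 0, Subtype.ext ?_⟩
    exact ((MvPolynomial.totalDegree_eq_zero_iff_eq_C).1
       (Nat.le_zero.1 (MvPolynomial.IsHomogeneous.totalDegree_le hp))).symm
  have h3 : IsClosedImmersion (Spec.map (CommRingCat.ofHom (algebraMap R
    (MvPolynomial.homogeneousSubmodule (Fin 2) R 0)))) := IsClosedImmersion.spec_of_surjective _ h2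
  have h4 := h3.isClosedEmbedding.isClosedMap _ h1
  exact (iff_of_eq (congrArg IsClosed ((congrArg (Set.image _) Set.image_singleton).trans
    Set.image_singleton))).1 h4

lemma C_mem_of_isClosed [IsLocalRing R] {x : projectiveLine R} (hx : IsClosed {x}) {d : R}
    (hd : d ∈ IsLocalRing.maximalIdeal R) :
    (MvPolynomial.C d : MvPolynomial (Fin 2) R) ∈ ProjectiveSpectrum.asHomogeneousIdeal x := by
  rw [← mem_projectiveLineToSpec_iff]
  have h1 := (PrimeSpectrum.isClosed_singleton_iff_isMaximal _).1
    (isClosed_projectiveLineToSpec R x hx)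
  rw [IsLocalRing.eq_maximalIdeal h1]
  exact hd

end ProjectiveLineToSpec

/-! ### Homogeneous primes of `R[T₀, T₁]` and forms that cut out closed points. -/

section PointsOfProjectiveLine
attribute [local instance] MvPolynomial.gradedAlgebra

open MvPolynomial IsLocalRing

lemma eval₂_mul_of_isHomogeneous {R S ι : Type*} [CommSemiring R] [CommSemiring S]
    {g : MvPolynomial ι R} {n : ℕ} (hg : g.IsHomogeneous n) (f : R →+* S) (r : S) (s : ι → S) :
    g.eval₂ f (fun i => r * s i) = r ^ n * g.eval₂ f s := by
  rw [eval₂_eq, eval₂_eq, Finset.mul_sum]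
  refine Finset.sum_congr rfl fun d hd => ?_
  have hd' : ∑ i ∈ d.support, d i = n := by
    simpa [Finsupp.weight_apply, Finsupp.sum] using hg (mem_support_iff.1 hd)
  simp only [mul_pow]
  rw [Finset.prod_mul_distrib, Finset.prod_pow_eq_pow_sum, hd']
  ring

lemma apply_eq_of_isHomogeneous {R S ι : Type*} [CommSemiring R] [CommSemiring S]
    {g : MvPolynomial ι R} {n : ℕ} (hg : g.IsHomogeneous n) (φ : MvPolynomial ι R →+* S) (r : S)
    (s : ι → S) (h : ∀ i, φ (X i) = r * s i) : φ g = r ^ n * g.eval₂ (φ.comp C) s := by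
  rw [← eval₂_mul_of_isHomogeneous hg, ← coe_eval₂Hom]
  refine RingHom.congr_fun (f := φ) (MvPolynomial.ringHom_ext (fun _ => ?_) fun i => ?_) g
  · simp
  · simp [h]

variable {R : Type u} [CommRing R]

/-- The homogeneous prime ideal generated by the forms in the kernel of a ring homomorphism from
`R[T₀, T₁]` to a field. -/
noncomputable def pointOfHom {K : Type*} [Field K] (φ : MvPolynomial (Fin 2) R →+* K)
    (i : Fin 2) (hi : φ (X i) ≠ 0) :
    ProjectiveSpectrum (homogeneousSubmodule (Fin 2) R) where
  asHomogeneousIdeal := (RingHom.ker φ).homogeneousCore _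
  isPrime := (RingHom.ker_isPrime φ).homogeneousCore
  not_irrelevant_le h := hi (Ideal.toIdeal_homogeneousCore_le _ _
    (h (HomogeneousIdeal.mem_irrelevant_of_mem _ one_pos (isHomogeneous_X R i))))

lemma mem_pointOfHom_iff {K : Type*} [Field K] (φ : MvPolynomial (Fin 2) R →+* K)
    (i : Fin 2) (hi : φ (X i) ≠ 0) {g : MvPolynomial (Fin 2) R} {n : ℕ}
    (hg : g.IsHomogeneous n) :
    g ∈ (pointOfHom φ i hi).asHomogeneousIdeal ↔ φ g = 0 :=
  ⟨fun h => Ideal.toIdeal_homogeneousCore_le _ _ h,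
    fun h => Ideal.mem_homogeneousCore_of_homogeneous_of_mem ⟨n, hg⟩ h⟩

lemma exists_X_notMem (x : ProjectiveSpectrum (homogeneousSubmodule (Fin 2) R)) :
    ∃ i, (X i : MvPolynomial (Fin 2) R) ∉ x.asHomogeneousIdeal := by
  by_contra! h
  refine x.not_irrelevant_le fun g hg => ?_
  have h1 : constantCoeff g = 0 := by
    have h2 : homogeneousComponent 0 g = 0 := by
      rw [HomogeneousIdeal.mem_irrelevant_iff] at hg
      exact (decomposition.decompose'_apply g 0).symm.trans hg
    rw [homogeneousComponent_zero] at h2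
    exact (C_eq_zero.1 h2)
  refine Ideal.Quotient.eq_zero_iff_mem.1 ?_
  have h3 : Ideal.Quotient.mk x.asHomogeneousIdeal.toIdeal =
      ((Ideal.Quotient.mk x.asHomogeneousIdeal.toIdeal).comp C).comp constantCoeff := by
    refine MvPolynomial.ringHom_ext (fun _ => by simp) fun i => ?_
    simpa using Ideal.Quotient.eq_zero_iff_mem.2 (h i)
  rw [h3, RingHom.comp_apply, h1, map_zero]

/-- An inclusion of homogeneous primes is a specialization, and it can be tested on forms. -/
lemma projectiveSpectrum_eq_of_isClosed
    {x y : ProjectiveSpectrum (homogeneousSubmodule (Fin 2) R)} (hx : IsClosed {x})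
    (h : ∀ n, ∀ g : MvPolynomial (Fin 2) R, g.IsHomogeneous n → g ∈ x.asHomogeneousIdeal →
      g ∈ y.asHomogeneousIdeal) : y = x := by
  have h1 : x ≤ y := by
    intro g hg
    rw [← sum_homogeneousComponent g]
    refine Ideal.sum_mem _ fun i _ => h i _ (homogeneousComponent_isHomogeneous i g) ?_
    have := x.asHomogeneousIdeal.isHomogeneous i hg
    exact (decomposition.decompose'_apply g i) ▸ this
  rw [ProjectiveSpectrum.le_iff_mem_closure, hx.closure_eq] at h1
  exact h1

/-- The map to the fraction field of the residue ring of a homogeneous prime ideal. -/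
noncomputable def toResidue (x : ProjectiveSpectrum (homogeneousSubmodule (Fin 2) R)) :
    MvPolynomial (Fin 2) R →+*
      FractionRing (MvPolynomial (Fin 2) R ⧸ x.asHomogeneousIdeal.toIdeal) :=
  (algebraMap (MvPolynomial (Fin 2) R ⧸ x.asHomogeneousIdeal.toIdeal) _).comp
    (Ideal.Quotient.mk _)

lemma toResidue_eq_zero_iff (x : ProjectiveSpectrum (homogeneousSubmodule (Fin 2) R))
    (g : MvPolynomial (Fin 2) R) : toResidue x g = 0 ↔ g ∈ x.asHomogeneousIdeal := by
  rw [toResidue, RingHom.comp_apply, FaithfulSMul.algebraMap_eq_zero_iff,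
    Ideal.Quotient.eq_zero_iff_mem]
  rfl

/-- The affine coordinate map `R[X] → Frac (R[T₀, T₁] / P)`, `X ↦ T₁ / T₀`. -/
noncomputable def affineCoord (x : ProjectiveSpectrum (homogeneousSubmodule (Fin 2) R)) :
    Polynomial R →+*
      FractionRing (MvPolynomial (Fin 2) R ⧸ x.asHomogeneousIdeal.toIdeal) :=
  Polynomial.eval₂RingHom ((toResidue x).comp C) (toResidue x (X 1) / toResidue x (X 0))

/-- Dehomogenization: `T₀ ↦ 1`, `T₁ ↦ X`. -/
noncomputable def dehomogenize : MvPolynomial (Fin 2) R →+* Polynomial R :=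
  eval₂Hom Polynomial.C ![1, Polynomial.X]

/-- At `x` the form takes the value `T₀ⁿ g(1, T₁ / T₀)`, with nonzero first factor. -/
lemma mem_iff_affineCoord (x : ProjectiveSpectrum (homogeneousSubmodule (Fin 2) R))
    (hx : (X 0 : MvPolynomial (Fin 2) R) ∉ x.asHomogeneousIdeal)
    {g : MvPolynomial (Fin 2) R} {n : ℕ} (hg : g.IsHomogeneous n) :
    g ∈ x.asHomogeneousIdeal ↔ affineCoord x (dehomogenize g) = 0 := by
  rw [← toResidue_eq_zero_iff] at hx ⊢
  rw [apply_eq_of_isHomogeneous hg (toResidue x) (toResidue x (X 0))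
    ![1, toResidue x (X 1) / toResidue x (X 0)]]
  · rw [mul_eq_zero, or_iff_right (pow_ne_zero n hx), ← coe_eval₂Hom]
    refine iff_of_eq (congrArg (· = 0) ?_)
    rw [← RingHom.comp_apply]
    refine RingHom.congr_fun (MvPolynomial.ringHom_ext (fun _ => ?_) fun i => ?_) g
    · simp [affineCoord, dehomogenize]
    · fin_cases i <;> simp [affineCoord, dehomogenize]
  · intro i
    fin_cases i
    · simp
    · simp [mul_div_cancel₀ _ hx]

/-- The form of degree `n` obtained from a polynomial of degree at most `n`. -/
noncomputable def homogenize (p : Polynomial R) (n : ℕ) : MvPolynomial (Fin 2) R :=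
  ∑ i ∈ Finset.range (n + 1), C (p.coeff i) * (X 0 ^ (n - i) * X 1 ^ i)

lemma isHomogeneous_homogenize (p : Polynomial R) (n : ℕ) :
    (homogenize p n).IsHomogeneous n := by
  refine IsHomogeneous.sum _ _ _ fun i hi => ?_
  have hi : n - i + i = n := Nat.sub_add_cancel (by simpa [Nat.lt_succ_iff] using hi)
  have h := ((isHomogeneous_X_pow (R := R) (0 : Fin 2) (n - i)).mul
    (isHomogeneous_X_pow (1 : Fin 2) i))
  rw [hi] at h
  simpa using (isHomogeneous_C (Fin 2) (p.coeff i)).mul h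

lemma dehomogenize_homogenize {p : Polynomial R} {n : ℕ} (hp : p.natDegree ≤ n) :
    dehomogenize (homogenize p n) = p := by
  conv_rhs => rw [p.as_sum_range' (n + 1) (Nat.lt_succ_of_le hp)]
  simp [homogenize, dehomogenize, Polynomial.C_mul_X_pow_eq_monomial]

/-- Modulo `T₀` the form is a positive power of `T₁`, so a zero with `T₀ = 0` would have both
coordinates zero. -/
lemma homogenize_mem_imp {p : Polynomial R} (hp : p.Monic) (hp0 : p.natDegree ≠ 0)
    {x : ProjectiveSpectrum (homogeneousSubmodule (Fin 2) R)}
    (h : homogenize p p.natDegree ∈ x.asHomogeneousIdeal) :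
    (X 0 : MvPolynomial (Fin 2) R) ∉ x.asHomogeneousIdeal := by
  intro h0
  have h1 : (X 1 : MvPolynomial (Fin 2) R) ∈ x.asHomogeneousIdeal := by
    rw [← toResidue_eq_zero_iff] at h h0 ⊢
    rw [homogenize, map_sum, Finset.sum_range_succ, Finset.sum_eq_zero, zero_add] at h
    · simpa [hp.coeff_natDegree, hp0] using h
    · intro i hi
      have : p.natDegree - i ≠ 0 := by simp at hi; omega
      simp [h0, this]
  obtain ⟨i, hi⟩ := exists_X_notMem x
  fin_cases i
  · exact hi h0
  · exact hi h1

variable [IsLocalRing R]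

lemma toResidue_C_eq_zero_iff {x : ProjectiveSpectrum (homogeneousSubmodule (Fin 2) R)}
    (hx : ∀ d ∈ maximalIdeal R, (C d : MvPolynomial (Fin 2) R) ∈ x.asHomogeneousIdeal) (d : R) :
    toResidue x (C d) = 0 ↔ d ∈ maximalIdeal R := by
  rw [toResidue_eq_zero_iff]
  refine ⟨fun h => ?_, hx d⟩
  by_contra hd
  exact x.isPrime.ne_top
    (Ideal.eq_top_of_isUnit_mem _ h ((IsLocalRing.notMem_maximalIdeal.1 hd).map C))

/-- A closed point of the projective line over a local ring is cut out in the closed fibre by a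
single form. -/
lemma exists_form_of_isClosed {x : ProjectiveSpectrum (homogeneousSubmodule (Fin 2) R)}
    (hx : IsClosed {x})
    (hxm : ∀ d ∈ maximalIdeal R, (C d : MvPolynomial (Fin 2) R) ∈ x.asHomogeneousIdeal) :
    ∃ n : ℕ, ∃ f : MvPolynomial (Fin 2) R, f.IsHomogeneous (n + 1) ∧
      ∀ y : ProjectiveSpectrum (homogeneousSubmodule (Fin 2) R),
        (∀ d ∈ maximalIdeal R, (C d : MvPolynomial (Fin 2) R) ∈ y.asHomogeneousIdeal) →
        f ∈ y.asHomogeneousIdeal → y = x := by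
  classical
  by_cases h0 : (X 0 : MvPolynomial (Fin 2) R) ∈ x.asHomogeneousIdeal
  · refine ⟨0, X 0, isHomogeneous_X R 0, fun y hym hy => ?_⟩
    -- At infinity a form takes the value `T₁ⁿ g(0, 1)`, so the closed fibre has only one point
    -- there.
    have key : ∀ z : ProjectiveSpectrum (homogeneousSubmodule (Fin 2) R),
        (∀ d ∈ maximalIdeal R, (C d : MvPolynomial (Fin 2) R) ∈ z.asHomogeneousIdeal) →
        (X 0 : MvPolynomial (Fin 2) R) ∈ z.asHomogeneousIdeal → ∀ n,
        ∀ g : MvPolynomial (Fin 2) R, g.IsHomogeneous n →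
        (g ∈ z.asHomogeneousIdeal ↔ eval ![0, 1] g ∈ maximalIdeal R) := by
      intro z hzm hz n g hg
      have h1 : toResidue z (X 1) ≠ 0 := by
        obtain ⟨i, hi⟩ := exists_X_notMem z
        fin_cases i
        · exact absurd hz hi
        · rwa [Ne, toResidue_eq_zero_iff]
      rw [← toResidue_eq_zero_iff, apply_eq_of_isHomogeneous hg (toResidue z) (toResidue z (X 1))
        ![0, 1], mul_eq_zero, or_iff_right (pow_ne_zero n h1), ← toResidue_C_eq_zero_iff hzm,
        ← coe_eval₂Hom]
      · refine iff_of_eq (congrArg (· = 0) ?_)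
        change _ = ((toResidue z).comp (C.comp (eval ![0, 1]))) g
        refine RingHom.congr_fun (MvPolynomial.ringHom_ext (fun _ => ?_) fun i => ?_) g
        · simp
        · fin_cases i <;> simp
      · intro i
        fin_cases i
        · simpa [toResidue_eq_zero_iff] using hz
        · simp
    exact projectiveSpectrum_eq_of_isClosed hx fun n g hg hgx =>
      (key y hym hy n g hg).2 ((key x hxm h0 n g hg).1 hgx)
  · let p := RingHom.ker (affineCoord x)
    have hker : ∀ z : ProjectiveSpectrum (homogeneousSubmodule (Fin 2) R),
        (∀ d ∈ maximalIdeal R, (C d : MvPolynomial (Fin 2) R) ∈ z.asHomogeneousIdeal) →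
        ∀ q : Polynomial R, q.map (residue R) = 0 → affineCoord z q = 0 := by
      intro z hzm q hq
      rw [affineCoord, Polynomial.coe_eval₂RingHom, Polynomial.eval₂_eq_sum]
      refine Finset.sum_eq_zero fun i _ => ?_
      have h1 : q.coeff i ∈ maximalIdeal R := by
        rw [← residue_eq_zero_iff, ← Polynomial.coeff_map, hq, Polynomial.coeff_zero]
      change toResidue z (C (q.coeff i)) * _ = 0
      rw [(toResidue_C_eq_zero_iff hzm _).2 h1, zero_mul]
    have hsurj : Function.Surjective (Polynomial.mapRingHom (residue R)) :=
      Polynomial.map_surjective _ residue_surjective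
    -- The kernel `p` contains all polynomials with coefficients in the maximal ideal, so it is
    -- determined by its image `P` in the principal ideal domain `k[X]`.
    let P : Ideal (Polynomial (ResidueField R)) := p.map (Polynomial.mapRingHom (residue R))
    have hP : ∀ q : Polynomial R, q.map (residue R) ∈ P ↔ affineCoord x q = 0 := by
      intro q
      refine ⟨fun h => ?_, fun h => Ideal.mem_map_of_mem _ h⟩
      obtain ⟨q', hq', h⟩ := (Ideal.mem_map_iff_of_surjective _ hsurj).1 h
      have h2 := hker x hxm (q' - q) (by
        rw [Polynomial.map_sub, sub_eq_zero]; exact h)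
      rw [map_sub, (show affineCoord x q' = 0 from hq'), zero_sub, neg_eq_zero] at h2
      exact h2
    -- If `P = 0`, then `x` specializes to the point `(1 : 0)` of the closed fibre and equals it,
    -- yet `T₁` vanishes at that point and `X ∉ P`.
    have hP0 : P ≠ ⊥ := by
      intro hbot
      let φ : MvPolynomial (Fin 2) R →+* ResidueField R :=
        (Polynomial.evalRingHom 0).comp
          ((Polynomial.mapRingHom (residue R)).comp dehomogenize)
      have hφ : φ (X 0) ≠ 0 := by simp [φ, dehomogenize]
      have hz : pointOfHom φ 0 hφ = x := projectiveSpectrum_eq_of_isClosed hx fun n g hg hgx => by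
        rw [mem_iff_affineCoord x h0 hg, ← hP, hbot, Ideal.mem_bot] at hgx
        rw [mem_pointOfHom_iff φ 0 hφ hg]
        simp [φ, hgx]
      have h1 : (X 1 : MvPolynomial (Fin 2) R) ∈ x.asHomogeneousIdeal := by
        rw [← hz, mem_pointOfHom_iff φ 0 hφ (isHomogeneous_X R 1)]
        simp [φ, dehomogenize]
      rw [mem_iff_affineCoord x h0 (isHomogeneous_X R 1), ← hP, hbot, Ideal.mem_bot] at h1
      simp [dehomogenize] at h1
    obtain ⟨b, hb⟩ := (IsPrincipalIdealRing.principal P).principal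
    have hb0 : b ≠ 0 := by
      rintro rfl
      exact hP0 (by rw [hb]; simp)
    -- A monic lift is taken so that the homogenized form has no zero at infinity.
    obtain ⟨f, hfb, hfdeg, hfm⟩ := Polynomial.lifts_and_natDegree_eq_and_monic
      ((Polynomial.mem_lifts _).2 (hsurj (normalize b))) (Polynomial.monic_normalize hb0)
    have hPf : P = Ideal.span {f.map (residue R)} := by
      rw [hb, hfb]
      exact Ideal.span_singleton_eq_span_singleton.2 (normalize_associated b).symm
    have hpos : f.natDegree ≠ 0 := by
      intro hzero
      rw [hfm.natDegree_eq_zero] at hzero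
      have h1 := (hP 1).1 (by rw [hPf, hzero]; exact Ideal.subset_span rfl)
      rw [map_one] at h1
      exact one_ne_zero h1
    obtain ⟨n, hn⟩ := Nat.exists_eq_succ_of_ne_zero hpos
    refine ⟨n, homogenize f f.natDegree, hn ▸ isHomogeneous_homogenize f _, fun y hym hy => ?_⟩
    have hy0 := homogenize_mem_imp hfm hpos hy
    rw [mem_iff_affineCoord y hy0 (isHomogeneous_homogenize f _),
      dehomogenize_homogenize le_rfl] at hy
    refine projectiveSpectrum_eq_of_isClosed hx fun n g hg hgx => ?_
    rw [mem_iff_affineCoord x h0 hg, ← hP, hPf, Ideal.mem_span_singleton] at hgx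
    rw [mem_iff_affineCoord y hy0 hg]
    obtain ⟨c, hc⟩ := hgx
    obtain ⟨c, rfl⟩ := hsurj c
    have h1 := hker y hym (dehomogenize g - f * c) (by
      rw [Polynomial.map_sub, hc, Polynomial.map_mul]; exact sub_self _)
    rw [map_sub, map_mul, hy, zero_mul, sub_zero] at h1
    exact h1

end PointsOfProjectiveLine

/-! ### The morphism `(1 : t)` from `Z` to the projective line. -/

namespace ZariskiRiemannSpace
section MorphismToProjectiveLine
attribute [local instance] MvPolynomial.gradedAlgebra

open MvPolynomial IsLocalRing

variable {F : Type u} [Field F] {D : Subring F}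

/-- Coordinates in `V` of the point `(1 : t)`: a multiple `(l, l t)` of `(1, t)` with entries in
`V`, one of which is `1`. -/
lemma exists_coords (t : F) (V : ZariskiRiemannSpace D) :
    ∃ (s : Fin 2 → V.ring) (l : F), l ≠ 0 ∧ (s 0 : F) = l ∧ (s 1 : F) = l * t ∧
      ∃ i, s i = 1 := by
  by_cases h : t ∈ V.ring
  · exact ⟨![1, ⟨t, h⟩], 1, one_ne_zero, rfl, by simp, 0, rfl⟩
  · have h0 : t ≠ 0 := fun h0 => h (h0 ▸ zero_mem _)
    have h1 : t⁻¹ ∈ V.ring := (V.ring.mem_or_inv_mem t).resolve_left h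
    exact ⟨![⟨t⁻¹, h1⟩, 1], t⁻¹, inv_ne_zero h0, rfl, by simp [h0], 1, rfl⟩

/-- The homogeneous coordinates of `(1 : t)` in `V`. -/
noncomputable def coords (t : F) (V : ZariskiRiemannSpace D) : Fin 2 → V.ring :=
  (exists_coords t V).choose

/-- The factor by which `coords t V` differs from `(1, t)`. -/
noncomputable def coordsFactor (t : F) (V : ZariskiRiemannSpace D) : F :=
  (exists_coords t V).choose_spec.choose

lemma coordsFactor_ne_zero (t : F) (V : ZariskiRiemannSpace D) : coordsFactor t V ≠ 0 :=
  (exists_coords t V).choose_spec.choose_spec.1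

lemma coords_zero (t : F) (V : ZariskiRiemannSpace D) : (coords t V 0 : F) = coordsFactor t V :=
  (exists_coords t V).choose_spec.choose_spec.2.1

lemma coords_one (t : F) (V : ZariskiRiemannSpace D) :
    (coords t V 1 : F) = coordsFactor t V * t :=
  (exists_coords t V).choose_spec.choose_spec.2.2.1

lemma exists_coords_eq_one (t : F) (V : ZariskiRiemannSpace D) : ∃ i, coords t V i = 1 :=
  (exists_coords t V).choose_spec.choose_spec.2.2.2

/-- Evaluation of polynomials at the coordinates in `V` of `(1 : t)`. -/
noncomputable def evalIn (t : F) (V : ZariskiRiemannSpace D) :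
    MvPolynomial (Fin 2) D →+* V.ring :=
  eval₂Hom (Subring.inclusion V.le_ring) (coords t V)

variable (D) in
/-- Evaluation of polynomials at `(1, t)`. -/
noncomputable def evalOne (t : F) : MvPolynomial (Fin 2) D →+* F :=
  eval₂Hom D.subtype ![1, t]

lemma coe_evalIn (t : F) (V : ZariskiRiemannSpace D) {g : MvPolynomial (Fin 2) D} {n : ℕ}
    (hg : g.IsHomogeneous n) :
    (evalIn t V g : F) = coordsFactor t V ^ n * evalOne D t g := by
  have h := apply_eq_of_isHomogeneous hg (V.ring.subtype.comp (evalIn t V)) (coordsFactor t V)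
    ![1, t] (fun i => by
      fin_cases i
      · simpa [evalIn] using coords_zero t V
      · simpa [evalIn] using coords_one t V)
  refine h.trans (congrArg _ ?_)
  rw [evalOne, coe_eval₂Hom]
  congr 1
  ext d
  simp only [evalIn, RingHom.comp_apply, eval₂Hom_C]
  rfl

/-- The image of `V` under the morphism to the projective line given by `(1 : t)`. -/
noncomputable def linePoint (t : F) (V : ZariskiRiemannSpace D) :
    ProjectiveSpectrum (homogeneousSubmodule (Fin 2) D) :=
  pointOfHom ((residue V.ring).comp (evalIn t V)) (exists_coords_eq_one t V).choose (by
    rw [RingHom.comp_apply, evalIn, eval₂Hom_X', (exists_coords_eq_one t V).choose_spec, map_one]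
    exact one_ne_zero)

lemma notMem_linePoint_iff (t : F) (V : ZariskiRiemannSpace D) {g : MvPolynomial (Fin 2) D}
    {n : ℕ} (hg : g.IsHomogeneous n) :
    g ∉ (linePoint t V).asHomogeneousIdeal ↔ IsUnit (evalIn t V g) := by
  rw [linePoint, mem_pointOfHom_iff _ _ _ hg, RingHom.comp_apply, residue_eq_zero_iff,
    IsLocalRing.notMem_maximalIdeal]

lemma evalOne_ne_zero {t : F} {V : ZariskiRiemannSpace D} {g : MvPolynomial (Fin 2) D}
    {n : ℕ} (hg : g.IsHomogeneous n) (h : g ∉ (linePoint t V).asHomogeneousIdeal) :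
    evalOne D t g ≠ 0 := by
  intro h0
  have h1 := coe_evalIn t V hg
  rw [h0, mul_zero] at h1
  exact ((notMem_linePoint_iff t V hg).1 h).ne_zero (Subtype.ext h1)

/-- A form of degree `n` does not vanish at the image of `V` if and only if its value at `(1, t)`
generates the `n`-th power of the ideal `(1, t)` of `V`. -/
lemma notMem_linePoint_iff_forall (t : F) (V : ZariskiRiemannSpace D)
    {g : MvPolynomial (Fin 2) D} {n : ℕ} (hg : g.IsHomogeneous n) :
    g ∉ (linePoint t V).asHomogeneousIdeal ↔
      evalOne D t g ≠ 0 ∧ ∀ i ≤ n, t ^ i / evalOne D t g ∈ V.ring := by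
  have hl := coordsFactor_ne_zero t V
  have hi : ∀ i ≤ n, t ^ i * coordsFactor t V ^ n =
      (coords t V 0 ^ (n - i) * coords t V 1 ^ i : V.ring) := by
    intro i hi
    push_cast
    rw [coords_zero, coords_one, mul_pow, ← mul_assoc, ← pow_add, Nat.sub_add_cancel hi, mul_comm]
  refine ⟨fun h => ⟨evalOne_ne_zero hg h, fun i hin => ?_⟩, fun ⟨h0, h⟩ => ?_⟩
  · obtain ⟨b, hb⟩ := ((notMem_linePoint_iff t V hg).1 h).exists_right_inv
    have hb' : coordsFactor t V ^ n * evalOne D t g * b = 1 := by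
      rw [← coe_evalIn t V hg]
      exact congrArg Subtype.val hb
    have : t ^ i / evalOne D t g =
        (coords t V 0 ^ (n - i) * coords t V 1 ^ i : V.ring) * (b : F) := by
      rw [← hi i hin, div_eq_iff (evalOne_ne_zero hg h)]
      linear_combination (-t ^ i) * hb'
    rw [this]
    exact mul_mem (SetLike.coe_mem _) b.2
  · rw [notMem_linePoint_iff t V hg]
    -- The hypothesis of `key` holds for `i = 0` or `i = n`, according to which coordinate is `1`;
    -- then `tⁱ / g(1, t)` is the required inverse.
    have key : ∀ i ≤ n, t ^ i * coordsFactor t V ^ n = 1 → IsUnit (evalIn t V g) := by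
      intro i hin h1
      refine IsUnit.of_mul_eq_one ⟨_, h i hin⟩ (Subtype.ext ?_)
      change (evalIn t V g : F) * (t ^ i / evalOne D t g) = 1
      rw [coe_evalIn t V hg, ← h1]
      field_simp
    obtain ⟨j, hj⟩ := exists_coords_eq_one t V
    fin_cases j
    · exact key 0 n.zero_le (by rw [hi 0 n.zero_le]; simp at hj; simp [hj])
    · exact key n le_rfl (by rw [hi n le_rfl]; simp at hj; simp [hj])

lemma isOpen_setOf_notMem_linePoint (t : F) {g : MvPolynomial (Fin 2) D} {n : ℕ}
    (hg : g.IsHomogeneous n) :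
    IsOpen {V : ZariskiRiemannSpace D | g ∉ (linePoint t V).asHomogeneousIdeal} := by
  simp only [notMem_linePoint_iff_forall t _ hg]
  have : {V : ZariskiRiemannSpace D | ∀ i ≤ n, t ^ i / evalOne D t g ∈ V.ring} =
      ⋂ i ∈ Set.Iic n, {V | t ^ i / evalOne D t g ∈ V.ring} := by
    ext
    simp
  exact isOpen_const.and (this ▸ (Set.finite_Iic n).isOpen_biInter fun i _ => isOpen_setOf_mem _)

lemma continuous_linePoint (t : F) :
    Continuous (linePoint t : ZariskiRiemannSpace D → _) := by
  rw [(ProjectiveSpectrum.isTopologicalBasis_basic_opens _).continuous_iff]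
  rintro _ ⟨g, rfl⟩
  beta_reduce
  -- A basic open set is the union of those of the homogeneous components, which reduces the claim
  -- to forms.
  rw [ProjectiveSpectrum.basicOpen_eq_union_of_projection, Opens.coe_iSup, Set.preimage_iUnion]
  exact isOpen_iUnion fun i => isOpen_setOf_notMem_linePoint t
    (SetLike.coe_mem (DirectSum.decompose (homogeneousSubmodule (Fin 2) D) g i))

/-- Evaluation at `(1, t)` of rational functions of degree zero that are defined at the image
of `V`. -/
noncomputable def evalFrac (t : F) (V : ZariskiRiemannSpace D)
    (z : HomogeneousLocalization.AtPrime (homogeneousSubmodule (Fin 2) D)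
      (linePoint t V).asHomogeneousIdeal.toIdeal) : F :=
  evalOne D t z.num / evalOne D t z.den

/-- The value does not depend on the fraction chosen: `D[T₀, T₁]` is a domain, so equal fractions
satisfy the cross-multiplied identity itself. -/
lemma evalFrac_mk (t : F) (V : ZariskiRiemannSpace D)
    (c : HomogeneousLocalization.NumDenSameDeg (homogeneousSubmodule (Fin 2) D)
      (linePoint t V).asHomogeneousIdeal.toIdeal.primeCompl) :
    evalFrac t V (.mk c) = evalOne D t c.num / evalOne D t c.den := by
  set z := HomogeneousLocalization.mk c with hz
  have h1 := HomogeneousLocalization.eq_num_div_den z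
  conv_lhs at h1 => rw [hz, HomogeneousLocalization.val_mk]
  rw [Localization.mk_eq_mk_iff, Localization.r_iff_exists] at h1
  obtain ⟨⟨e, he⟩, h⟩ := h1
  have he0 : e ≠ 0 := by
    rintro rfl
    exact he (zero_mem _)
  have h2 := congrArg (evalOne D t) (mul_left_cancel₀ he0 h)
  rw [map_mul, map_mul] at h2
  rw [evalFrac, div_eq_div_iff (evalOne_ne_zero z.den_mem_deg z.den_mem)
    (evalOne_ne_zero c.den.2 c.den_mem)]
  rw [mul_comm, ← h2, mul_comm]

/-- `evalFrac` as a ring homomorphism. -/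
noncomputable def evalFracHom (t : F) (V : ZariskiRiemannSpace D) :
    HomogeneousLocalization.AtPrime (homogeneousSubmodule (Fin 2) D)
      (linePoint t V).asHomogeneousIdeal.toIdeal →+* F where
  toFun := evalFrac t V
  map_one' := by
    rw [← HomogeneousLocalization.mk_one, evalFrac_mk]
    simp
  map_zero' := by
    rw [← HomogeneousLocalization.mk_zero, evalFrac_mk]
    simp
  map_mul' x y := by
    obtain ⟨x, rfl⟩ := HomogeneousLocalization.mk_surjective x
    obtain ⟨y, rfl⟩ := HomogeneousLocalization.mk_surjective y
    rw [← HomogeneousLocalization.mk_mul, evalFrac_mk, evalFrac_mk, evalFrac_mk]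
    simp [div_mul_div_comm]
  map_add' x y := by
    obtain ⟨x, rfl⟩ := HomogeneousLocalization.mk_surjective x
    obtain ⟨y, rfl⟩ := HomogeneousLocalization.mk_surjective y
    rw [← HomogeneousLocalization.mk_add, evalFrac_mk, evalFrac_mk, evalFrac_mk]
    rw [div_add_div _ _ (evalOne_ne_zero x.den.2 x.den_mem) (evalOne_ne_zero y.den.2 y.den_mem)]
    simp
    ring

lemma evalFrac_mk_mul (t : F) (V : ZariskiRiemannSpace D)
    (c : HomogeneousLocalization.NumDenSameDeg (homogeneousSubmodule (Fin 2) D)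
      (linePoint t V).asHomogeneousIdeal.toIdeal.primeCompl) :
    evalFrac t V (.mk c) * evalIn t V c.den = evalIn t V c.num := by
  rw [evalFrac_mk, coe_evalIn t V c.den.2, coe_evalIn t V c.num.2]
  have := evalOne_ne_zero c.den.2 c.den_mem
  field_simp

lemma evalFrac_mem (t : F) (V : ZariskiRiemannSpace D) (z) : evalFrac t V z ∈ V.ring := by
  obtain ⟨c, rfl⟩ := HomogeneousLocalization.mk_surjective z
  obtain ⟨b, hb⟩ := ((notMem_linePoint_iff t V c.den.2).1 c.den_mem).exists_right_inv
  have hb' : (evalIn t V c.den : F) * b = 1 := congrArg Subtype.val hb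
  have : evalFrac t V (.mk c) = evalIn t V c.num * b := by
    rw [← evalFrac_mk_mul, mul_assoc, hb', mul_one]
  rw [this]
  exact mul_mem (SetLike.coe_mem _) b.2

/-- This makes the stalk maps of `lineMorphism` local. -/
lemma isUnit_of_evalFrac (t : F) (V : ZariskiRiemannSpace D)
    (z : HomogeneousLocalization.AtPrime (homogeneousSubmodule (Fin 2) D)
      (linePoint t V).asHomogeneousIdeal.toIdeal)
    (h : IsUnit (⟨evalFrac t V z, evalFrac_mem t V z⟩ : V.ring)) : IsUnit z := by
  obtain ⟨c, rfl⟩ := HomogeneousLocalization.mk_surjective z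
  rw [isUnit_mk_atPrime_iff]
  refine (notMem_linePoint_iff t V c.num.2).2 ?_
  have : evalIn t V c.num = ⟨evalFrac t V (.mk c), evalFrac_mem t V _⟩ * evalIn t V c.den :=
    Subtype.ext (evalFrac_mk_mul t V c).symm
  rw [this]
  exact h.mul ((notMem_linePoint_iff t V c.den.2).1 c.den_mem)

variable {Z : Set (ZariskiRiemannSpace D)}

variable (Z) in
/-- The continuous map from `Z` to the projective line given by `(1 : t)`. -/
noncomputable def lineMap (t : F) :
    TopCat.of Z ⟶ TopCat.of (ProjectiveSpectrum (homogeneousSubmodule (Fin 2) D)) :=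
  TopCat.ofHom ⟨fun V => linePoint t V.1, (continuous_linePoint t).comp continuous_subtype_val⟩

/-- Locally the section is a fraction `a / b`, with constant value `a(1, t) / b(1, t)`. The local
constants agree because all nonempty open sets share the point `F`. -/
lemma evalFrac_section_mem (hZ : ⊤ ∈ Z) (t : F)
    (W : Opens (ProjectiveSpectrum.top (homogeneousSubmodule (Fin 2) D)))
    (s : (ProjectiveSpectrum.Proj.structureSheaf (homogeneousSubmodule (Fin 2) D)).1.obj (op W)) :
    (fun V : (Opens.map (lineMap Z t)).obj W => evalFrac t V.1.1 (s.1 ⟨linePoint t V.1.1, V.2⟩)) ∈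
      sections Z ((Opens.map (lineMap Z t)).obj W) := by
  refine (sectionPredicate hZ).locality _ fun V => ?_
  obtain ⟨W', hVW', i, n, a, b, hb, hs⟩ := s.2 ⟨linePoint t V.1.1, V.2⟩
  have key : ∀ V' : (Opens.map (lineMap Z t)).obj W',
      evalFrac t V'.1.1 (s.1 ⟨linePoint t V'.1.1, i.le V'.2⟩) =
        evalOne D t a / evalOne D t b := by
    intro V'
    have h1 := hs ⟨linePoint t V'.1.1, V'.2⟩
    exact (congrArg (evalFrac t V'.1.1) h1).trans (evalFrac_mk t V'.1.1 _)
  refine ⟨(Opens.map (lineMap Z t)).obj W', hVW', (Opens.map (lineMap Z t)).map i,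
    evalOne D t a / evalOne D t b, fun V' => ?_, key⟩
  exact key V' ▸ evalFrac_mem t V'.1.1 _

/-- The ring maps of the morphism to the projective line. -/
noncomputable def lineSections (hZ : ⊤ ∈ Z) (t : F)
    (W : Opens (ProjectiveSpectrum.top (homogeneousSubmodule (Fin 2) D))) :
    (ProjectiveSpectrum.Proj.structureSheaf (homogeneousSubmodule (Fin 2) D)).1.obj (op W) ⟶
      CommRingCat.of (sections Z ((Opens.map (lineMap Z t)).obj W)) := CommRingCat.ofHom
  { toFun s := ⟨_, evalFrac_section_mem hZ t W s⟩
    map_one' := Subtype.ext (funext fun V => (evalFracHom t V.1.1).map_one)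
    map_zero' := Subtype.ext (funext fun V => (evalFracHom t V.1.1).map_zero)
    map_mul' _ _ := Subtype.ext (funext fun V => (evalFracHom t V.1.1).map_mul _ _)
    map_add' _ _ := Subtype.ext (funext fun V => (evalFracHom t V.1.1).map_add _ _) }

/-- The morphism of presheafed spaces underlying `lineMorphism`. -/
noncomputable def linePresheafedMorphism (hZ : ⊤ ∈ Z) (t : F) :
    (toLocallyRingedSpace Z hZ).toPresheafedSpace.Hom
      (projectiveLine D).toLocallyRingedSpace.toPresheafedSpace where
  base := lineMap Z t
  c := { app := fun W => lineSections hZ t W.unop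
         naturality := fun _ _ _ => rfl }

/-- The morphism from `Z` to the projective line given by `(1 : t)`. -/
noncomputable def lineMorphism (hZ : ⊤ ∈ Z) (t : F) :
    toLocallyRingedSpace Z hZ ⟶ (projectiveLine D).toLocallyRingedSpace where
  toHom := linePresheafedMorphism hZ t
  prop V := by
    refine ⟨fun z hz => ?_⟩
    obtain ⟨W, hW, s, rfl⟩ :=
      (projectiveLine D).presheaf.exists_germ_eq z
    have h1 := PresheafedSpace.stalkMap_germ_apply (linePresheafedMorphism hZ t) W V hW s
    have h2 : IsUnit ((presheaf Z).germ ((Opens.map (lineMap Z t)).obj W) V hW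
        ((lineSections hZ t W).hom s)) := (iff_of_eq (congrArg IsUnit h1)).1 hz
    have h3 := h2.map (stalkEquiv (Z := Z) V)
    have h4 : stalkEquiv (Z := Z) V ((presheaf Z).germ ((Opens.map (lineMap Z t)).obj W) V hW
        ((lineSections hZ t W).hom s)) = ⟨evalFrac t V.1 (s.1 ⟨linePoint t V.1, hW⟩),
          evalFrac_mem t V.1 _⟩ := stalkTo_germ (Z := Z) _ V hW ((lineSections hZ t W).hom s)
    rw [h4] at h3
    exact (isUnit_germ_iff (homogeneousSubmodule (Fin 2) D) (linePoint t V.1) W hW s).2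
      (isUnit_of_evalFrac t V.1 _ h3)

lemma lineMorphism_toΓ (hZ : ⊤ ∈ Z) (t : F) (d : D) :
    (lineSections hZ t ⊤).hom ((projectiveLineConst D).hom d) = baseToSections Z ⊤ d := by
  refine Subtype.ext (funext fun V => ?_)
  refine (evalFrac_mk t V.1.1 _).trans ?_
  change evalOne D t (C d) / evalOne D t 1 = d
  simp [evalOne]

/-- The target is affine, so naturality of `toΓSpec` reduces the claim to global sections, where
constants evaluate to themselves. -/
lemma lineMorphism_comp (hZ : ⊤ ∈ Z) (t : F) :
    lineMorphism hZ t ≫ (projectiveLineToSpec D).toLRSHom = structureMorphism Z hZ := by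
  have h1 : (projectiveLineToSpec D).toLRSHom =
      (projectiveLine D).toLocallyRingedSpace.toΓSpec ≫
        Spec.locallyRingedSpaceMap (projectiveLineConst D) :=
    congrArg Scheme.Hom.toLRSHom (projectiveLineToSpec_eq D)
  refine (congrArg (lineMorphism hZ t ≫ ·) h1).trans ?_
  refine (Category.assoc _ _ _).symm.trans ?_
  have h2 := identityToΓSpec.naturality (lineMorphism hZ t)
  refine (congrArg (· ≫ Spec.locallyRingedSpaceMap (projectiveLineConst D)) h2).trans ?_
  refine (Category.assoc _ _ _).trans ?_
  refine congrArg ((toLocallyRingedSpace Z hZ).toΓSpec ≫ ·) ?_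
  refine (Spec.locallyRingedSpaceMap_comp _ _).symm.trans ?_
  refine congrArg Spec.locallyRingedSpaceMap ?_
  refine CommRingCat.hom_ext (RingHom.ext fun d => lineMorphism_toΓ hZ t d)

end MorphismToProjectiveLine
end ZariskiRiemannSpace

/-! ### Forms that vanish nowhere on the image of `Z`. -/

namespace ZariskiRiemannSpace
section FormsAvoidingPoints
attribute [local instance] MvPolynomial.gradedAlgebra

open MvPolynomial IsLocalRing

variable {F : Type u} [Field F] {D : Subring F} {Z : Set (ZariskiRiemannSpace D)}

lemma C_mem_linePoint_iff (t : F) (V : ZariskiRiemannSpace D) (d : D) :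
    (C d : MvPolynomial (Fin 2) D) ∈ (linePoint t V).asHomogeneousIdeal ↔
      (⟨(d : F), V.le_ring d.2⟩ : V.ring) ∈ maximalIdeal V.ring := by
  rw [← not_iff_not, notMem_linePoint_iff t V (isHomogeneous_C _ d), evalIn, eval₂Hom_C,
    IsLocalRing.notMem_maximalIdeal]
  rfl

/-- Among the perturbations `g + dᵉ X`, `e ≥ 1`, of a form `g` outside a homogeneous prime ideal,
at most one lies in it if `d` is in the maximal ideal. -/
lemma subsingleton_setOf_perturb_mem {R : Type u} [CommRing R] [IsLocalRing R] {d : R}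
    (hd : d ∈ maximalIdeal R) {P : Ideal (MvPolynomial (Fin 2) R)}
    {g q : MvPolynomial (Fin 2) R} (hg : g ∉ P) :
    {e : ℕ | g + C d ^ (e + 1) * q ∈ P}.Subsingleton := by
  -- The difference of two perturbations is `dᵉ⁺¹ (1 - dᵏ⁺¹) q` with `1 - dᵏ⁺¹` a unit, so two
  -- members of `P` would force `g ∈ P`.
  have key : ∀ e k : ℕ, g + C d ^ (e + 1) * q ∈ P → g + C d ^ (e + (k + 1) + 1) * q ∉ P := by
    intro e k h1 h2
    have hu : IsUnit (C (1 - d ^ (k + 1)) : MvPolynomial (Fin 2) R) := by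
      refine IsUnit.map C ((IsLocalRing.isUnit_or_isUnit_one_sub_self _).resolve_left ?_)
      exact Ideal.pow_mem_of_mem _ hd _ k.succ_pos
    have h3 : C (1 - d ^ (k + 1)) * (C d ^ (e + 1) * q) ∈ P := by
      have : C (1 - d ^ (k + 1)) * (C d ^ (e + 1) * q) =
          (g + C d ^ (e + 1) * q) - (g + C d ^ (e + (k + 1) + 1) * q) := by
        rw [map_sub, map_one, map_pow]
        ring
      exact this ▸ sub_mem h1 h2
    exact hg ((P.add_mem_iff_left ((Ideal.unit_mul_mem_iff_mem _ hu).1 h3)).1 h1)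
  intro a ha b hb
  by_contra hab
  rcases Nat.lt_or_gt_of_ne hab with h | h
  · obtain ⟨k, rfl⟩ := Nat.exists_eq_add_of_lt h
    exact key a k ha hb
  · obtain ⟨k, rfl⟩ := Nat.exists_eq_add_of_lt h
    exact key b k hb ha

lemma evalOne_eq_sum (t : F) {g : MvPolynomial (Fin 2) D} {n : ℕ} (hg : g.IsHomogeneous n) :
    ∃ c : ℕ → D, evalOne D t g = ∑ i ∈ Finset.range (n + 1), (c i : F) * t ^ i := by
  refine ⟨fun i => ∑ m ∈ g.support with m 1 = i, g.coeff m, ?_⟩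
  rw [evalOne, coe_eval₂Hom, eval₂_eq, ← Finset.sum_fiberwise_of_maps_to
    (t := Finset.range (n + 1)) (g := fun m => m 1)]
  · refine Finset.sum_congr rfl fun i _ => ?_
    push_cast
    rw [Finset.sum_mul]
    refine Finset.sum_congr rfl fun m hm => ?_
    rw [Finset.prod_subset (Finset.subset_univ _) (by simp +contextual)]
    simp [← (Finset.mem_filter.1 hm).2]
  · intro m hm
    have h1 : m.degree = n := by
      rw [Finsupp.degree_eq_weight_one]
      exact hg (mem_support_iff.1 hm)
    exact Finset.mem_range.2 (Nat.lt_succ_of_le (h1 ▸ Finsupp.le_degree 1 m))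

variable [IsLocalRing D]

/-- A form that does not vanish at the images of the dominating valuation rings can be chosen such
that it does not vanish at the images of finitely many other valuation rings. -/
lemma exists_form_notMem_linePoint (t : F) {n : ℕ} {f : MvPolynomial (Fin 2) D}
    (hf : f.IsHomogeneous n)
    (hfZ : ∀ V ∈ Z, V.Dominates → f ∉ (linePoint t V).asHomogeneousIdeal)
    (hfin : {V ∈ Z | ¬ V.Dominates}.Finite) :
    ∃ g : MvPolynomial (Fin 2) D, g.IsHomogeneous n ∧
      ∀ V ∈ Z, g ∉ (linePoint t V).asHomogeneousIdeal := by
  suffices h : ∃ g : MvPolynomial (Fin 2) D, g.IsHomogeneous n ∧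
      (∀ V ∈ Z, V.Dominates → g ∉ (linePoint t V).asHomogeneousIdeal) ∧
      ∀ V ∈ {V ∈ Z | ¬ V.Dominates}, g ∉ (linePoint t V).asHomogeneousIdeal by
    obtain ⟨g, hg, h1, h2⟩ := h
    exact ⟨g, hg, fun V hV => (Classical.em V.Dominates).elim (h1 V hV)
      fun hd => h2 V ⟨hV, hd⟩⟩
  refine hfin.induction_on_subset _ ⟨f, hf, hfZ, by simp⟩ ?_
  rintro V₀ S hV₀ hS - ⟨g, hg, hgZ, hgS⟩
  by_cases h0 : g ∈ (linePoint t V₀).asHomogeneousIdeal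
  swap
  · refine ⟨g, hg, hgZ, ?_⟩
    rintro V (rfl | hV)
    · exact h0
    · exact hgS V hV
  -- The term `dᵉ⁺¹ Xⱼⁿ` vanishes at the images of dominating rings but not at that of `V₀`, where
  -- `d` is a unit and the coordinate `j` is `1`. Each ring treated before excludes at most one `e`.
  obtain ⟨d, hd, hdV⟩ : ∃ d ∈ maximalIdeal D,
      (⟨(d : F), V₀.le_ring d.2⟩ : V₀.ring) ∉ maximalIdeal V₀.ring := by
    simpa [Dominates] using hV₀.2
  obtain ⟨j, hj⟩ := exists_coords_eq_one t V₀
  obtain ⟨e, he⟩ : ∃ e : ℕ, e ∉ ⋃ V ∈ S,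
      {e : ℕ | g + C d ^ (e + 1) * X j ^ n ∈ (linePoint t V).asHomogeneousIdeal.toIdeal} :=
    Set.Finite.exists_notMem ((hfin.subset hS).biUnion fun V hV =>
      (subsingleton_setOf_perturb_mem hd (hgS V hV)).finite)
  refine ⟨g + C d ^ (e + 1) * X j ^ n, hg.add ?_, fun V hV hdom h => hgZ V hV hdom ?_, ?_⟩
  · simpa using ((isHomogeneous_C (Fin 2) d).pow (e + 1)).mul (isHomogeneous_X_pow j n)
  · have h1 : C d ^ (e + 1) * X j ^ n ∈ (linePoint t V).asHomogeneousIdeal.toIdeal :=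
      Ideal.mul_mem_right _ _ (Ideal.pow_mem_of_mem _
        ((C_mem_linePoint_iff t V d).2 (hdom d hd)) _ e.succ_pos)
    exact (Ideal.add_mem_iff_left _ h1).1 h
  · rintro V (rfl | hV) h
    · have h1 := (Ideal.add_mem_iff_right (linePoint t V).asHomogeneousIdeal.toIdeal h0).1 h
      rcases (linePoint t V).isPrime.mem_or_mem h1 with h2 | h2
      · exact hdV ((C_mem_linePoint_iff t V d).1 ((linePoint t V).isPrime.mem_of_pow_mem _ h2))
      · refine (notMem_linePoint_iff t V (isHomogeneous_X D j)).2 ?_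
          ((linePoint t V).isPrime.mem_of_pow_mem _ h2)
        rw [evalIn, eval₂Hom_X', hj]
        exact isUnit_one
    · exact he (Set.mem_biUnion hV h)

lemma hasPrincipalPowers_holomorphyRing (hZ : ⊤ ∈ Z)
    (hfin : {V ∈ Z | ¬ V.Dominates}.Finite)
    (hmor : ∀ φ : toLocallyRingedSpace Z hZ ⟶ (projectiveLine D).toLocallyRingedSpace,
      φ ≫ (projectiveLineToSpec D).toLRSHom = structureMorphism Z hZ →
      ∃ x : projectiveLine D, IsClosed {x} ∧ x ∉ Set.range φ.base) :
    HasPrincipalPowers (holomorphyRing Z) F := by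
  intro t
  obtain ⟨x, hx, hxφ⟩ := hmor (lineMorphism hZ t) (lineMorphism_comp hZ t)
  obtain ⟨n, f, hf, hfx⟩ := exists_form_of_isClosed (R := D) (x := x) hx
    fun d hd => C_mem_of_isClosed D hx hd
  obtain ⟨g, hg, hgZ⟩ := exists_form_notMem_linePoint t hf (fun V hV hdom h => hxφ
    ⟨⟨V, hV⟩, hfx (linePoint t V) (fun d hd => (C_mem_linePoint_iff t V d).2 (hdom d hd)) h⟩) hfin
  have h := fun V hV => (notMem_linePoint_iff_forall t V hg).1 (hgZ V hV)
  obtain ⟨c, hc⟩ := evalOne_eq_sum t hg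
  have hD : D ≤ holomorphyRing Z := le_iInf₂ fun V _ => V.le_ring
  -- The generator is `u = g(1, t)`, nonzero by the criterion at `F ∈ Z`; each `tⁱ / u` lies in
  -- every `V ∈ Z`, hence in `A`.
  refine ⟨n, evalOne D t g, (h ⊤ hZ).1, fun i hi => ⟨⟨_, ?_⟩, rfl⟩, fun i => ⟨c i, hD (c i).2⟩,
    hc.symm⟩
  exact Subring.mem_iInf.2 fun V => Subring.mem_iInf.2 fun hV => (h V hV).2 i hi

end FormsAvoidingPoints
end ZariskiRiemannSpace

theorem theorem4p2 {F : Type u} [Field F] (D : Subring F) [IsLocalRing D]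
    [IsIntegrallyClosedIn D F] (Z : Set (ZariskiRiemannSpace D)) (hZ : ⊤ ∈ Z)
    (hfin : {V ∈ Z | ¬ V.Dominates}.Finite)
    (hmor : ∀ φ : ZariskiRiemannSpace.toLocallyRingedSpace Z hZ ⟶
        (projectiveLine D).toLocallyRingedSpace,
      φ ≫ (projectiveLineToSpec D).toLRSHom = ZariskiRiemannSpace.structureMorphism Z hZ →
      ∃ x : projectiveLine D, IsClosed {x} ∧ x ∉ Set.range φ.base) :
    IsPruferDomain (ZariskiRiemannSpace.holomorphyRing Z) ∧
      IsMulTorsion (CommRing.Pic (ZariskiRiemannSpace.holomorphyRing Z)) ∧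
      IsFractionRing (ZariskiRiemannSpace.holomorphyRing Z) F := by
  have h := ZariskiRiemannSpace.hasPrincipalPowers_holomorphyRing hZ hfin hmor
  have hfrac := h.isFractionRing
  exact ⟨⟨inferInstance, fun P _ => h.valuationRing_localization P⟩, h.isMulTorsion_pic, hfrac⟩
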